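/- **Proposition.** Let $b(z)=\sum_{n\in\mathbb Z} b(n)z^{-n}$, $c(z)=\sum_{n\in\mathbb Z} c(n)z^{-n-1}$ be a pair of fermionic fields, $[b(m),c(n)]_+=\delta_{m,-n}$, $[b(m),b(n)]_+=[c(m),c(n)]_+=0$, and let $\mathcal F$ be their Fock space, with vacuum $|bc\rangle$ satisfying $b(n+1)|bc\rangle=c(n)|bc\rangle=0$ for $n\ge 0$. Put $$j(z)=\,:b(z)c(z):\,=\sum_n j_nz^{-n-1},\qquad T(z)=\,:\partial b(z)c(z):\,=\sum_n L_nz^{-n-2},$$ $$\widetilde W(z)=\tfrac12\bigl(:\partial^2b(z)c(z):-:\partial b(z)\partial c(z):\bigr)=\sum_n\widetilde W_nz^{-n-3}.$$ For $\alpha\in\mathbb C$ let $H_\alpha$ be the Fock space of the Heisenberg algebra $[j_m,j_n]=m\delta_{m,-n}$ with vacuum vector $|\alpha\rangle$, $j_n|\alpha\rangle=\alpha\delta_{n,0}|\alpha\rangle$ for $n\ge0$. By the boson-fermion correspondence the Heisenberg vertex algebra $H_0$ is identified with the charge zero subspace $\mathcal F^0=\ker j_0$ of $\mathcal F$ (the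 vacuum going to $|bc\rangle$, and $j_n$ to $j_n$). The simple $\mathcal W_3$ algebra $\mathcal W_{3,-2}$ of central charge $-2$ is realized as the vertex subalgebra $\ker(c(0)|_{\mathcal F^0})$ of $\mathcal F^0\cong H_0$, the states of its generating fields $T(z)$ and $\widetilde W(z)$ being $\omega=L_{-2}|bc\rangle$ and $\widetilde w=\widetilde W_{-3}|bc\rangle$. Each $H_\alpha$ is a module over the vertex algebra $H_0$, hence over $\mathcal W_{3,-2}$; denote by $L_n$, $\widetilde W_n$ also the corresponding modes of the fields of $\omega$ and $\widetilde w$ on $H_\alpha$. The states $\omega$ and $\widetilde w$ correspond to unique elements of $H_0$ and lie in $\mathcal W_{3,-2}$. For $\alpha\in\mathbb C$ let $V_\alpha$ be the quotient of the $\mathcal W_{3,-2}$-submodule of $H_\alpha$ generated by $|\alpha\rangle$ by the sum of all its proper submodules. Then $V_\alpha$ is irreducible, and the image $v$ of $|\alpha\rangle$ is a highest weight vector of $V_\alpha$ with highest weight $$\left(\tfrac12\alpha(\alpha-1),\ \tfrac16\alpha(\alpha-1)(2\alpha-1)\right)$$ with respect to $(L_0,\widetilde W_0)$; that is, $v\neq0$,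 $v$ generates $V_\alpha$, $L_nv=\widetilde W_nv=0$ for all $n>0$, $L_0v=\tfrac12\alpha(\alpha-1)v$ and $\widetilde W_0v=\tfrac16\alpha(\alpha-1)(2\alpha-1)v$. -/

import Mathlib

noncomputable section

namespace WThree

/-! ### Fields on a complex vector space -/

/-- A field `a(z) = ∑ₙ a₍ₙ₎ z^{-n-1}` on `V`: linear modes `a₍ₙ₎ : V → V` such that, for every
vector `v`, one has `a₍ₙ₎ v = 0` for all sufficiently large `n`. -/
structure FormalField (V : Type) [AddCommGroup V] [Module ℂ V] where
  mode : ℤ → V →ₗ[ℂ] V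
  trunc : ∀ v : V, ∃ N : ℤ, ∀ n : ℤ, N ≤ n → mode n v = 0

namespace FormalField

variable {V : Type} [AddCommGroup V] [Module ℂ V]

/-- The constant field `I_V`. -/
def one : FormalField V where
  mode n := if n = -1 then LinearMap.id else 0
  trunc v := ⟨0, fun n hn => by
    have : n ≠ -1 := by omega
    simp [this]⟩

/-- The scalar multiple `r a(z)`. -/
def smul (r : ℂ) (a : FormalField V) : FormalField V where
  mode n := r • a.mode n
  trunc v := by
    obtain ⟨N, hN⟩ := a.trunc v
    exact ⟨N, fun n hn => by simp [hN n hn]⟩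

/-- The difference `a(z) - b(z)`. -/
def sub (a b : FormalField V) : FormalField V where
  mode n := a.mode n - b.mode n
  trunc v := by
    obtain ⟨N, hN⟩ := a.trunc v
    obtain ⟨M, hM⟩ := b.trunc v
    exact ⟨max N M, fun n hn => by
      simp [hN n (le_trans (le_max_left _ _) hn), hM n (le_trans (le_max_right _ _) hn)]⟩

/-- The derivative `∂a(z)`: its `n`-th mode is `-n a₍ₙ₋₁₎`. -/
def deriv (a : FormalField V) : FormalField V where
  mode n := (-(n : ℂ)) • a.mode (n - 1)
  trunc v := by
    obtain ⟨N, hN⟩ := a.trunc v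
    exact ⟨N + 1, fun n hn => by simp [hN (n - 1) (by omega)]⟩

/-- The divided derivative `∂^{(i)} a(z) = (1 / i!) ∂^i a(z)`. -/
def divDeriv (i : ℕ) (a : FormalField V) : FormalField V :=
  smul ((Nat.factorial i : ℂ)⁻¹) (deriv^[i] a)

theorem support_finite (s : ℂ) (a b : FormalField V) (n : ℤ) (v : V) :
    (Function.support fun k : ℕ =>
      a.mode (-(k : ℤ) - 1) (b.mode (n + k) v) + s • b.mode (n - k - 1) (a.mode k v)).Finite := by
  obtain ⟨N, hN⟩ := a.trunc v
  obtain ⟨M, hM⟩ := b.trunc v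
  refine (Set.finite_Iio (max N (M - n)).toNat).subset fun k hk => ?_
  by_contra hlt
  simp only [Set.mem_Iio, not_lt] at hlt
  apply hk
  have h1 : N ≤ (k : ℤ) := by omega
  have h2 : M ≤ n + (k : ℤ) := by omega
  simp [hN _ h1, hM _ h2]

/-- The normally ordered product `:a(z) b(z):`. With `s = 1` for even fields and `s = -1` for odd
ones, `(:ab:)₍ₙ₎ = ∑_{k < 0} a₍ₖ₎ b₍ₙ₋ₖ₋₁₎ + s ∑_{k ≥ 0} b₍ₙ₋ₖ₋₁₎ a₍ₖ₎`; on every vector only finitely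
many terms are non-zero. -/
def normalProd (s : ℂ) (a b : FormalField V) : FormalField V where
  mode n :=
    { toFun := fun v => ∑ᶠ k : ℕ,
        (a.mode (-(k : ℤ) - 1) (b.mode (n + k) v) + s • b.mode (n - k - 1) (a.mode k v))
      map_add' := fun v w => by
        rw [← finsum_add_distrib (support_finite s a b n v) (support_finite s a b n w)]
        refine finsum_congr fun k => ?_
        simp only [map_add, smul_add]
        abel
      map_smul' := fun r v => by
        rw [RingHom.id_apply, smul_finsum' r (support_finite s a b n v)]
        refine finsum_congr fun k => ?_
        simp only [map_smul, smul_add, smul_comm s r] }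
  trunc v := by
    obtain ⟨N, hN⟩ := a.trunc v
    obtain ⟨M, hM⟩ := b.trunc v
    choose P hP using fun k : ℕ => b.trunc (a.mode k v)
    obtain ⟨B, hB⟩ := ((Finset.range N.toNat).image P).bddAbove
    refine ⟨max M (B + N.toNat + 1), fun n hn => ?_⟩
    have hn1 : M ≤ n := le_trans (le_max_left _ _) hn
    have hn2 : B + N.toNat + 1 ≤ n := le_trans (le_max_right _ _) hn
    change (∑ᶠ k : ℕ, _) = (0 : V)
    refine finsum_eq_zero_of_forall_eq_zero fun k => ?_
    rw [hM (n + k) (by omega), map_zero, zero_add]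
    by_cases hk : k < N.toNat
    · have h1 : P k ≤ B := hB (Finset.mem_coe.2
        (Finset.mem_image_of_mem P (Finset.mem_range.2 hk)))
      rw [hP k _ (by omega), smul_zero]
    · rw [hN k (by omega), map_zero, smul_zero]

end FormalField

/-! ### The fermionic Fock space of the `bc` fields -/

/-- The Fock space of the `bc` fields: the exterior algebra on the creation modes, where
`Sum.inl i` stands for `b(-i)` and `Sum.inr i` for `c(-i-1)`, `i ≥ 0`. -/
abbrev BCFock : Type := ExteriorAlgebra ℂ ((ℕ ⊕ ℕ) →₀ ℂ)

/-- The vacuum vector of the `bc` Fock space. -/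
def bcVacuum : BCFock := 1

/-- Creation operator: left exterior multiplication by a generator. -/
def create (x : ℕ ⊕ ℕ) : BCFock →ₗ[ℂ] BCFock :=
  LinearMap.mulLeft ℂ (ExteriorAlgebra.ι ℂ (Finsupp.single x 1))

/-- Annihilation operator: contraction with the coordinate functional dual to a generator. -/
def annihilate (x : ℕ ⊕ ℕ) : BCFock →ₗ[ℂ] BCFock :=
  CliffordAlgebra.contractLeft (Q := (0 : QuadraticForm ℂ ((ℕ ⊕ ℕ) →₀ ℂ))) (Finsupp.lapply x)

/-- The operators `b(n)`: creation for `n ≤ 0`, annihilation (dual to `c(-n)`) for `n ≥ 1`. -/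
def bOp (n : ℤ) : BCFock →ₗ[ℂ] BCFock :=
  if n ≤ 0 then create (Sum.inl (-n).toNat) else annihilate (Sum.inr (n - 1).toNat)

/-- The operators `c(n)`: creation for `n ≤ -1`, annihilation (dual to `b(-n)`) for `n ≥ 0`. -/
def cOp (n : ℤ) : BCFock →ₗ[ℂ] BCFock :=
  if n < 0 then create (Sum.inr (-n - 1).toNat) else annihilate (Sum.inl n.toNat)

theorem annihilate_finite (v : BCFock) : {x | annihilate x v ≠ 0}.Finite := by
  induction v using CliffordAlgebra.left_induction with
  | algebraMap r =>
    refine Set.finite_empty.subset fun x hx => ?_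
    exact hx (CliffordAlgebra.contractLeft_algebraMap (Q := (0 : QuadraticForm ℂ ((ℕ ⊕ ℕ) →₀ ℂ)))
      (Finsupp.lapply x) r)
  | add v w hv hw =>
    refine (hv.union hw).subset fun x hx => ?_
    by_contra h
    simp only [Set.mem_union, Set.mem_ofPred_eq, not_or, not_not] at h
    exact hx (by rw [map_add, h.1, h.2, add_zero])
  | ι_mul v m hv =>
    refine (hv.union m.support.finite_toSet).subset fun x hx => ?_
    by_contra h
    simp only [Set.mem_union, Set.mem_ofPred_eq, not_or, not_not, Finset.mem_coe,
      Finsupp.mem_support_iff] at h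
    refine hx ((CliffordAlgebra.contractLeft_ι_mul _ _ _).trans ?_)
    have h1 := h.1
    rw [annihilate] at h1
    rw [h1, Finsupp.lapply_apply, h.2]
    simp

theorem exists_bound {X : Type} [AddCommGroup X] {S : Set (ℕ ⊕ ℕ)} (hS : S.Finite)
    (f : ℕ → ℕ ⊕ ℕ) (hf : Function.Injective f) (A : ℕ ⊕ ℕ → X)
    (hA : ∀ x, x ∉ S → A x = 0) : ∃ N : ℕ, ∀ n, N ≤ n → A (f n) = 0 := by
  obtain ⟨B, hB⟩ := (hS.preimage hf.injOn).bddAbove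
  refine ⟨B + 1, fun n hn => hA _ fun hmem => ?_⟩
  have : n ≤ B := hB hmem
  omega

/-- The field `b(z) = ∑ b(n) z^{-n}`, so `b₍ₙ₎ = b(n+1)`. -/
def bField : FormalField BCFock where
  mode n := bOp (n + 1)
  trunc v := by
    obtain ⟨N, hN⟩ := exists_bound (annihilate_finite v) Sum.inr Sum.inr_injective
      (fun x => annihilate x v) fun x hx => not_not.1 hx
    refine ⟨N, fun n hn => ?_⟩
    rw [bOp, if_neg (by omega)]
    exact hN _ (by omega)

/-- The field `c(z) = ∑ c(n) z^{-n-1}`, so `c₍ₙ₎ = c(n)`. -/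
def cField : FormalField BCFock where
  mode n := cOp n
  trunc v := by
    obtain ⟨N, hN⟩ := exists_bound (annihilate_finite v) Sum.inl Sum.inl_injective
      (fun x => annihilate x v) fun x hx => not_not.1 hx
    refine ⟨N, fun n hn => ?_⟩
    rw [cOp, if_neg (by omega)]
    exact hN _ (by omega)

/-- The free boson `j(z) = :b(z) c(z):`. -/
def jField : FormalField BCFock := bField.normalProd (-1) cField

/-- The Virasoro field `T(z) = :∂b(z) c(z):`. -/
def TField : FormalField BCFock := bField.deriv.normalProd (-1) cField

/-- The weight three field `W̃(z) = ½ (:∂²b(z) c(z): - :∂b(z) ∂c(z):)`. -/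
def WField : FormalField BCFock :=
  FormalField.smul (1 / 2)
    ((bField.deriv.deriv.normalProd (-1) cField).sub
      (bField.deriv.normalProd (-1) cField.deriv))

/-! ### The Heisenberg Fock spaces -/

/-- The underlying space of every Heisenberg Fock space `H_α`: polynomials in variables `x_i`,
`i ≥ 0`, where `x_i` stands for `j_{-i-1}` and `1` is the vacuum vector. -/
def HFock : Type := MvPolynomial ℕ ℂ

instance : CommRing HFock := inferInstanceAs (CommRing (MvPolynomial ℕ ℂ))

instance : Algebra ℂ HFock := inferInstanceAs (Algebra ℂ (MvPolynomial ℕ ℂ))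

/-- The variable `x_i`, i.e. `j_{-i-1}` applied to the vacuum vector. -/
def hX (i : ℕ) : HFock := (MvPolynomial.X i : MvPolynomial ℕ ℂ)

/-- The partial derivative `∂/∂x_i`. -/
def hDeriv (i : ℕ) : HFock →ₗ[ℂ] HFock :=
  (MvPolynomial.pderiv i : Derivation ℂ (MvPolynomial ℕ ℂ) (MvPolynomial ℕ ℂ)).toLinearMap

/-- The basis of monomials. -/
def hBasis : Module.Basis (ℕ →₀ ℕ) ℂ HFock := MvPolynomial.basisMonomials ℕ ℂ

/-- The vacuum vector `|α⟩` of `H_α`. -/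
def hVacuum : HFock := 1

/-- The action of `j_n` on `H_α`: multiplication by `x_{-n-1}` for `n < 0`, the scalar `α` for
`n = 0`, and `n ∂/∂x_{n-1}` for `n > 0`. -/
def heisenberg (α : ℂ) (n : ℤ) : HFock →ₗ[ℂ] HFock :=
  if n < 0 then LinearMap.mulLeft ℂ (hX (-n - 1).toNat)
  else if n = 0 then α • LinearMap.id
  else (n : ℂ) • hDeriv (n - 1).toNat

/-- The field `j(z) = ∑ j_n z^{-n-1}` on `H_α`. -/
def heisenbergField (α : ℂ) : FormalField HFock where
  mode := heisenberg α
  trunc v := by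
    obtain ⟨B, hB⟩ := (MvPolynomial.vars (R := ℂ) v).bddAbove
    refine ⟨B + 2, fun n hn => ?_⟩
    rw [heisenberg, if_neg (by omega), if_neg (by omega)]
    have : (n - 1).toNat ∉ MvPolynomial.vars (R := ℂ) v := fun h => by
      have : (n - 1).toNat ≤ B := hB (Finset.mem_coe.2 h)
      omega
    have h0 : hDeriv (n - 1).toNat v = 0 := MvPolynomial.pderiv_eq_zero_of_notMem_vars this
    rw [LinearMap.smul_apply, h0, smul_zero]

/-- The list `[i₁, …, i_r]` of the indices of a monomial `x_{i₁} ⋯ x_{i_r}`, in increasing order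
and with multiplicities. -/
def indices (m : ℕ →₀ ℕ) : List ℕ := (Finsupp.toMultiset m).sort (· ≤ ·)

/-- The field on `H_α` of the state `j_{-i₁-1} ⋯ j_{-i_r-1} |0⟩` of `H_0`, namely
`:∂^{(i₁)} j(z) ⋯ ∂^{(i_r)} j(z):`. -/
def monomialField (α : ℂ) (m : ℕ →₀ ℕ) : FormalField HFock :=
  (indices m).foldr
    (fun i f => ((heisenbergField α).divDeriv i).normalProd 1 f) FormalField.one

/-- The action of the vertex algebra `H_0` on its module `H_α`: `vertexMode α n a` is the mode
`a₍ₙ₎` of the field `Y(a, z) = ∑ a₍ₙ₎ z^{-n-1}` on `H_α` of the state `a ∈ H_0`. -/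
def vertexMode (α : ℂ) (n : ℤ) : HFock →ₗ[ℂ] Module.End ℂ HFock :=
  hBasis.constr ℂ fun m => (monomialField α m).mode n

/-! ### The boson-fermion correspondence and the vertex algebra `W_{3,-2}` -/

/-- The boson-fermion correspondence in charge zero: the map of modules over the Heisenberg algebra
from `H_0` to the `bc` Fock space which sends the vacuum to the vacuum, i.e.
`j_{-i₁-1} ⋯ j_{-i_r-1} |0⟩` is sent to the vector given by the same expression in the modes of
`j(z) = :b(z) c(z):`. It is an isomorphism onto the charge zero subspace (the kernel of `j_0`). -/
def bosonFermion : HFock →ₗ[ℂ] BCFock :=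
  hBasis.constr ℂ fun m =>
    (indices m).foldr (fun i v => jField.mode (-(i : ℤ) - 1) v) bcVacuum

/-- `W_{3,-2}` as a vertex subalgebra of `H_0`: under the boson-fermion correspondence it is the
kernel of the screening operator `c(0)` on the charge zero subspace of the `bc` Fock space. -/
def wAlgebra : Submodule ℂ HFock := (LinearMap.ker (cOp 0)).comap bosonFermion

/-- `ω ∈ H_0` corresponds to `L_{-2} |bc⟩`, the state of the field `T(z) = ∑ L_n z^{-n-2}`. -/
def IsVirasoroState (ω : wAlgebra) : Prop := bosonFermion ω = TField.mode (-1) bcVacuum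

/-- `w ∈ H_0` corresponds to `W̃_{-3} |bc⟩`, the state of the field `W̃(z) = ∑ W̃_n z^{-n-3}`. -/
def IsWState (w : wAlgebra) : Prop := bosonFermion w = WField.mode (-1) bcVacuum

/-! ### The modules `V_α` -/

/-- The associative algebra of operators on `H_α` generated by all the modes of all the fields of
`W_{3,-2}`. The `W_{3,-2}`-submodules of `H_α` are its submodules over this algebra. -/
def ModeAlgebra (α : ℂ) : Type :=
  Algebra.adjoin ℂ {f : Module.End ℂ HFock | ∃ a : wAlgebra, ∃ n : ℤ, f = vertexMode α n a}

instance (α : ℂ) : Ring (ModeAlgebra α) := inferInstanceAs (Ring (Algebra.adjoin ℂ _))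

instance (α : ℂ) : Algebra ℂ (ModeAlgebra α) := inferInstanceAs (Algebra ℂ (Algebra.adjoin ℂ _))

/-- The tautological action of the algebra of modes on `H_α`. -/
instance (α : ℂ) : Module (ModeAlgebra α) HFock :=
  inferInstanceAs (Module (Algebra.adjoin ℂ {f : Module.End ℂ HFock |
    ∃ a : wAlgebra, ∃ n : ℤ, f = vertexMode α n a}) HFock)

instance (α : ℂ) : IsScalarTower ℂ (ModeAlgebra α) HFock :=
  inferInstanceAs (IsScalarTower ℂ (Algebra.adjoin ℂ {f : Module.End ℂ HFock |
    ∃ a : wAlgebra, ∃ n : ℤ, f = vertexMode α n a}) HFock)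

/-- The mode `a₍ₙ₎`, `a ∈ W_{3,-2}`, as an element of the algebra of modes on `H_α`. -/
def stateMode (α : ℂ) (a : wAlgebra) (n : ℤ) : ModeAlgebra α :=
  ⟨vertexMode α n a, Algebra.subset_adjoin ⟨a, n, rfl⟩⟩

theorem stateMode_smul (α : ℂ) (a : wAlgebra) (n : ℤ) (x : HFock) :
    stateMode α a n • x = vertexMode α n a x := rfl

/-- The `W_{3,-2}`-submodule of `H_α` generated by the vacuum vector `|α⟩`. -/
abbrev Generated (α : ℂ) : Submodule (ModeAlgebra α) HFock :=
  Submodule.span (ModeAlgebra α) {hVacuum}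

/-- The sum of all proper submodules of the submodule generated by `|α⟩`. -/
def maxProper (α : ℂ) : Submodule (ModeAlgebra α) (Generated α) :=
  sSup {U | U ≠ ⊤}

/-- The `W_{3,-2}`-module `V_α`: the irreducible quotient of the submodule of `H_α` generated by
the vacuum vector. -/
abbrev V (α : ℂ) : Type := Generated α ⧸ maxProper α

/-- The image of `|α⟩` in `V_α`. -/
def highestVector (α : ℂ) : V α :=
  (maxProper α).mkQ ⟨hVacuum, Submodule.mem_span_singleton_self _⟩

/-- `v` is a highest weight vector of `V_α` of highest weight `(t, u)` with respect to
`(L_0, W̃_0)`: it is non-zero, generates `V_α`, is killed by `L_n` and `W̃_n` for `n > 0`, and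
satisfies `L_0 v = t v`, `W̃_0 v = u v`. Here `L_n` is the mode `ω₍ₙ₊₁₎` and `W̃_n` the mode
`w₍ₙ₊₂₎`. -/
def IsHighestWeightVector (α : ℂ) (ω w : wAlgebra) (v : V α) (t u : ℂ) : Prop :=
  v ≠ 0 ∧ Submodule.span (ModeAlgebra α) {v} = ⊤ ∧
    (∀ n : ℤ, 0 < n → stateMode α ω (n + 1) • v = 0 ∧ stateMode α w (n + 2) • v = 0) ∧
    stateMode α ω 1 • v = t • v ∧ stateMode α w 2 • v = u • v

end WThree

end

/-!
The two states are found explicitly in the Heisenberg Fock space. Since `[j_m, b(k)] = b(k + m)` and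
`[j_m, c(k)] = -c(k + m)` on the fermionic Fock space, the vector `b(-1)c(-1)|bc⟩ = L_{-2}|bc⟩` is the
image of `½ (j_{-1}² + j_{-2})|0⟩`, and `b(-2)c(-1)|bc⟩ - ½ b(-1)c(-2)|bc⟩ = W̃_{-3}|bc⟩` is the image of
`(⅓ j_{-1}³ + ½ j_{-1}j_{-2} + ⅙ j_{-3})|0⟩`; neither vector involves `b(0)`, so `c(0)` kills both.

Uniqueness is the injectivity of the boson-fermion map (`bosonFermion_injective`). By the Heisenberg
relations `jField_comm` the map intertwines `m ∂/∂x_{m-1}` with the mode `j_m`, `m > 0`, so its kernel is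
stable under all partial derivatives. The creation modes `j_{-m}` have image without vacuum component,
so an element of the kernel has no constant term. Both facts together make every coefficient vanish.

On `H_α` the mode `L_0` acts on a monomial of conformal degree `d` as the scalar `½α(α-1) + d`
(`vertexMode_virasoroState_hBasis`), and the vacuum spans the part of degree `0`. A polynomial in `L_0`
projects any given vector to its constant term, so a submodule of the module generated by `|α⟩` that
contains a vector with non-zero constant term contains `|α⟩` and is everything
(`coord_zero_of_mem`). Hence all proper submodules, and therefore their sum, consist of vectors without
constant term: the sum is the largest proper submodule and does not contain `|α⟩`, which makes the quotient
simple and the image of `|α⟩` a non-zero generator.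

For the weights, only `j_0 = α` of the left factor contributes when a mode of `:j(z) f(z):` of high enough
index is applied to `|α⟩` (`VacuumWeight.normalProd`). This gives `½(α² - α)` for `L_0` and
`⅓α³ - ½α² + ⅙α` for `W̃_0`, and `0` for the positive modes.
-/

noncomputable section

namespace WThree

/-! ### Canonical anticommutation relations -/

theorem create_create (x y : ℕ ⊕ ℕ) (v : BCFock) :
    create x (create y v) = -create y (create x v) := by
  have h := ExteriorAlgebra.ι_add_mul_swap (R := ℂ) (Finsupp.single x (1 : ℂ))
    (Finsupp.single y (1 : ℂ))
  simp only [create, LinearMap.mulLeft_apply, ← mul_assoc]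
  rw [eq_neg_of_add_eq_zero_left h, neg_mul]

theorem annihilate_annihilate (x y : ℕ ⊕ ℕ) (v : BCFock) :
    annihilate x (annihilate y v) = -annihilate y (annihilate x v) :=
  CliffordAlgebra.contractLeft_comm _ _ _

theorem annihilate_create (x y : ℕ ⊕ ℕ) (v : BCFock) :
    annihilate x (create y v) = (if x = y then v else 0) - create y (annihilate x v) := by
  refine (CliffordAlgebra.contractLeft_ι_mul _ _ _).trans ?_
  rw [Finsupp.lapply_apply, Finsupp.single_apply]
  congr 1
  by_cases h : x = y
  · simp [h]
  · simp [h, Ne.symm h]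

theorem annihilate_vacuum (x : ℕ ⊕ ℕ) : annihilate x bcVacuum = 0 :=
  CliffordAlgebra.contractLeft_one (Q := (0 : QuadraticForm ℂ ((ℕ ⊕ ℕ) →₀ ℂ)))
    (Finsupp.lapply x)

theorem bOp_bOp (m n : ℤ) (v : BCFock) : bOp m (bOp n v) = -bOp n (bOp m v) := by
  unfold bOp
  split_ifs
  · exact create_create _ _ _
  · rw [annihilate_create, if_neg (by simp), zero_sub, neg_neg]
  · rw [annihilate_create, if_neg (by simp), zero_sub]
  · exact annihilate_annihilate _ _ _

theorem cOp_cOp (m n : ℤ) (v : BCFock) : cOp m (cOp n v) = -cOp n (cOp m v) := by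
  unfold cOp
  split_ifs
  · exact create_create _ _ _
  · rw [annihilate_create, if_neg (by simp), zero_sub, neg_neg]
  · rw [annihilate_create, if_neg (by simp), zero_sub]
  · exact annihilate_annihilate _ _ _

theorem eq_zero_of_eq_neg {v : BCFock} (h : v = -v) : v = 0 := by
  have h2 : (2 : ℂ) • v = 0 := by rw [two_smul, ← sub_neg_eq_add, ← h, sub_self]
  exact (smul_eq_zero.1 h2).resolve_left two_ne_zero

theorem bOp_bOp_self (m : ℤ) (v : BCFock) : bOp m (bOp m v) = 0 :=
  eq_zero_of_eq_neg (bOp_bOp m m v)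

theorem cOp_cOp_self (m : ℤ) (v : BCFock) : cOp m (cOp m v) = 0 :=
  eq_zero_of_eq_neg (cOp_cOp m m v)

theorem bOp_cOp (m n : ℤ) (v : BCFock) :
    bOp m (cOp n v) = (if m + n = 0 then v else 0) - cOp n (bOp m v) := by
  unfold bOp cOp
  split_ifs <;> first
    | omega
    | (rw [create_create, zero_sub])
    | (rw [annihilate_annihilate, zero_sub])
    | (rw [annihilate_create, if_pos (by congr 1; omega)]; done)
    | (rw [annihilate_create, if_neg (by intro h; injection h; omega)]; done)
    | (rw [annihilate_create, if_pos (by congr 1; omega)]; abel)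
    | (rw [annihilate_create, if_neg (by intro h; injection h; omega)]; abel)

theorem cOp_bOp (m n : ℤ) (v : BCFock) :
    cOp n (bOp m v) = (if m + n = 0 then v else 0) - bOp m (cOp n v) := by
  rw [bOp_cOp]; abel

theorem bOp_vacuum {n : ℤ} (hn : 0 < n) : bOp n bcVacuum = 0 := by
  rw [bOp, if_neg (by omega), annihilate_vacuum]

theorem cOp_vacuum {n : ℤ} (hn : 0 ≤ n) : cOp n bcVacuum = 0 := by
  rw [cOp, if_neg (by omega), annihilate_vacuum]

theorem bOp_cOp_vacuum {m : ℤ} (hm : 0 < m) (n : ℤ) :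
    bOp m (cOp n bcVacuum) = if m + n = 0 then bcVacuum else 0 := by
  rw [bOp_cOp, bOp_vacuum hm, map_zero, sub_zero]

/-- An operator commuting with all creation operators is determined by its value on the vacuum. -/
theorem eq_smul_of_commute_create (C : BCFock →ₗ[ℂ] BCFock)
    (hC : ∀ x v, C (create x v) = create x (C v)) {r : ℂ} (h1 : C bcVacuum = r • bcVacuum)
    (v : BCFock) : C v = r • v := by
  have hι : ∀ (m : (ℕ ⊕ ℕ) →₀ ℂ) (v : BCFock),
      C (ExteriorAlgebra.ι ℂ m * v) = ExteriorAlgebra.ι ℂ m * C v := by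
    intro m v
    induction m using Finsupp.induction_linear with
    | zero => simp
    | add f g hf hg => simp only [map_add, add_mul, hf, hg]
    | single x a =>
      have h : Finsupp.single x a = a • Finsupp.single x (1 : ℂ) := by simp
      have h2 := hC x v
      simp only [create, LinearMap.mulLeft_apply] at h2
      rw [h, map_smul, smul_mul_assoc, smul_mul_assoc, map_smul, h2]
  induction v using CliffordAlgebra.left_induction with
  | algebraMap a =>
    have h : algebraMap ℂ BCFock a = a • bcVacuum := Algebra.algebraMap_eq_smul_one a
    exact (congrArg C h).trans (by
      rw [map_smul, h1, smul_comm]; exact congrArg (r • ·) h.symm)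
  | add v w hv hw => rw [map_add, hv, hw, smul_add]
  | ι_mul v m hv =>
    exact (hι m v).trans (by rw [hv, mul_smul_comm])

/-! ### The free boson on the fermionic Fock space -/

theorem jField_apply (m : ℤ) (v : BCFock) :
    jField.mode m v =
      ∑ᶠ i : ℕ, (bOp (-i) (cOp (m + i) v) - cOp (m - i - 1) (bOp (i + 1) v)) := by
  change ∑ᶠ i : ℕ, _ = _
  refine finsum_congr fun i => ?_
  simp only [bField, cField, neg_smul, one_smul, sub_eq_add_neg, neg_add_cancel_right]

theorem jField_support (m : ℤ) (v : BCFock) :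
    (Function.support fun i : ℕ =>
      bOp (-i) (cOp (m + i) v) - cOp (m - i - 1) (bOp (i + 1) v)).Finite := by
  refine (FormalField.support_finite (-1) bField cField m v).subset fun i hi => ?_
  simpa only [bField, cField, neg_smul, one_smul, sub_eq_add_neg, neg_add_cancel_right,
    Function.mem_support] using hi

/-- `[j_m, b(k)] = b(k + m)`. Of the two halves of the normally ordered sum, the first contributes
when `k + m ≤ 0` and the second when `k + m > 0`. -/
theorem jField_bOp (m k : ℤ) (v : BCFock) :
    jField.mode m (bOp k v) = bOp k (jField.mode m v) + bOp (k + m) v := by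
  rw [← sub_eq_iff_eq_add', jField_apply, jField_apply,
    ← LinearMap.toAddMonoidHom_coe, AddMonoidHom.map_finsum _ (jField_support m v),
    ← finsum_sub_distrib (by exact jField_support m (bOp k v))
      (((jField_support m v)).subset fun i hi h => hi (by simp [h]))]
  trans ∑ᶠ i : ℕ, ((if (i : ℤ) = -k - m then bOp (k + m) v else 0) +
    if (i : ℤ) = k + m - 1 then bOp (k + m) v else 0)
  · refine finsum_congr fun i => ?_
    have e1 : bOp (-i) (cOp (m + i) (bOp k v)) =
        (if k + (m + i) = 0 then bOp (-i) v else 0) + bOp k (bOp (-i) (cOp (m + i) v)) := by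
      rw [cOp_bOp, map_sub, bOp_bOp _ k]
      split_ifs <;> simp
    have e2 : cOp (m - i - 1) (bOp (i + 1) (bOp k v)) =
        bOp k (cOp (m - i - 1) (bOp (i + 1) v)) -
          (if k + (m - i - 1) = 0 then bOp (i + 1) v else 0) := by
      rw [bOp_bOp, map_neg, cOp_bOp]
      abel
    simp only [LinearMap.toAddMonoidHom_coe, map_sub]
    rw [e1, e2]
    have e3 : (if k + (m + (i : ℤ)) = 0 then bOp (-i) v else 0) =
        if (i : ℤ) = -k - m then bOp (k + m) v else 0 := by
      split_ifs with h h' <;> first | omega | rfl | skip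
      congr 2; omega
    have e4 : (if k + (m - (i : ℤ) - 1) = 0 then bOp (i + 1) v else 0) =
        if (i : ℤ) = k + m - 1 then bOp (k + m) v else 0 := by
      split_ifs with h h' <;> first | omega | rfl | skip
      congr 2; omega
    rw [e3, e4]
    abel
  · by_cases h : k + m ≤ 0
    · rw [finsum_eq_single _ (-k - m).toNat fun i hi => by
        rw [if_neg (by omega), if_neg (by omega), add_zero]]
      rw [if_pos (by omega), if_neg (by omega), add_zero]
    · rw [finsum_eq_single _ (k + m - 1).toNat fun i hi => by
        rw [if_neg (by omega), if_neg (by omega), add_zero]]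
      rw [if_neg (by omega), if_pos (by omega), zero_add]

/-- `[j_m, c(k)] = -c(k + m)`. -/
theorem jField_cOp (m k : ℤ) (v : BCFock) :
    jField.mode m (cOp k v) = cOp k (jField.mode m v) - cOp (k + m) v := by
  rw [sub_eq_add_neg, ← sub_eq_iff_eq_add', jField_apply, jField_apply,
    ← LinearMap.toAddMonoidHom_coe, AddMonoidHom.map_finsum _ (jField_support m v),
    ← finsum_sub_distrib (by exact jField_support m (cOp k v))
      (((jField_support m v)).subset fun i hi h => hi (by simp [h]))]
  trans ∑ᶠ i : ℕ, ((if (i : ℤ) = k then -cOp (k + m) v else 0) +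
    if (i : ℤ) = -k - 1 then -cOp (k + m) v else 0)
  · refine finsum_congr fun i => ?_
    have e1 : bOp (-i) (cOp (m + i) (cOp k v)) =
        cOp k (bOp (-i) (cOp (m + i) v)) - (if -i + k = 0 then cOp (m + i) v else 0) := by
      rw [cOp_cOp, map_neg, bOp_cOp]
      abel
    have e2 : cOp (m - i - 1) (bOp (i + 1) (cOp k v)) =
        (if i + 1 + k = 0 then cOp (m - i - 1) v else 0) +
          cOp k (cOp (m - i - 1) (bOp (i + 1) v)) := by
      rw [bOp_cOp, map_sub, cOp_cOp _ k]
      split_ifs <;> simp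
    simp only [LinearMap.toAddMonoidHom_coe, map_sub]
    rw [e1, e2]
    have e3 : (if -(i : ℤ) + k = 0 then cOp (m + i) v else 0) =
        if (i : ℤ) = k then cOp (k + m) v else 0 := by
      split_ifs with h h' <;> first | omega | rfl | skip
      congr 2; omega
    have e4 : (if (i : ℤ) + 1 + k = 0 then cOp (m - i - 1) v else 0) =
        if (i : ℤ) = -k - 1 then cOp (k + m) v else 0 := by
      split_ifs with h h' <;> first | omega | rfl | skip
      congr 2; omega
    rw [e3, e4]
    split_ifs <;> abel
  · by_cases h : 0 ≤ k
    · rw [finsum_eq_single _ k.toNat fun i hi => by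
        rw [if_neg (by omega), if_neg (by omega), add_zero]]
      rw [if_pos (by omega), if_neg (by omega), add_zero]
    · rw [finsum_eq_single _ (-k - 1).toNat fun i hi => by
        rw [if_neg (by omega), if_neg (by omega), add_zero]]
      rw [if_neg (by omega), if_pos (by omega), zero_add]

theorem jField_vacuum_of_nonneg {m : ℤ} (hm : 0 ≤ m) : jField.mode m bcVacuum = 0 := by
  rw [jField_apply]
  refine finsum_eq_zero_of_forall_eq_zero fun i => ?_
  rw [cOp_vacuum (by omega), bOp_vacuum (by omega)]
  simp

theorem jField_vacuum (N : ℕ) :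
    jField.mode (-N) bcVacuum = ∑ i ∈ Finset.range N, bOp (-i) (cOp (i - N) bcVacuum) := by
  rw [jField_apply, finsum_eq_sum_of_support_subset (s := Finset.range N)]
  · refine Finset.sum_congr rfl fun i _ => ?_
    rw [bOp_vacuum (n := i + 1) (by omega), map_zero, sub_zero, neg_add_eq_sub]
  · intro i hi
    rw [Finset.coe_range, Set.mem_Iio]
    by_contra h
    refine hi ?_
    change bOp _ _ - cOp _ (bOp _ _) = 0
    rw [bOp_vacuum (n := i + 1) (by omega), cOp_vacuum (by omega)]
    simp

theorem jField_jField_vacuum {m : ℕ} (hm : 0 < m) (N : ℕ) :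
    jField.mode m (jField.mode (-N) bcVacuum) =
      (if m = N then (m : ℂ) else 0) • bcVacuum := by
  have step : jField.mode m (jField.mode (-N) bcVacuum) =
      ∑ k ∈ Finset.range N, bOp (m - k) (cOp (k - N) bcVacuum) -
        ∑ k ∈ Finset.range N, bOp (-k) (cOp (k - N + m) bcVacuum) := by
    rw [jField_vacuum, map_sum, ← Finset.sum_sub_distrib]
    refine Finset.sum_congr rfl fun k _ => ?_
    rw [jField_bOp, jField_cOp, jField_vacuum_of_nonneg (by omega), map_zero, zero_sub, map_neg,
      neg_add_eq_sub, neg_add_eq_sub]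
  have hlow : ∀ k : ℕ, k < m → bOp (m - k) (cOp (k - N) bcVacuum) =
      if m = N then bcVacuum else 0 := by
    intro k hk
    rw [bOp_cOp_vacuum (by omega)]
    exact if_congr (by omega) rfl rfl
  rw [step]
  rcases le_or_gt N m with h | h
  · have h1 : ∀ k ∈ Finset.range N, bOp (m - k) (cOp (k - N) bcVacuum) =
        if m = N then bcVacuum else 0 :=
      fun k hk => hlow k (lt_of_lt_of_le (Finset.mem_range.1 hk) h)
    have h2 : ∀ k ∈ Finset.range N, bOp (-k) (cOp (k - N + m) bcVacuum) = 0 := fun k _ => by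
      rw [cOp_vacuum (by omega), map_zero]
    rw [Finset.sum_congr rfl h1, Finset.sum_eq_zero h2, Finset.sum_const, Finset.card_range,
      sub_zero]
    split_ifs with e
    · rw [← e, Nat.cast_smul_eq_nsmul]
    · simp
  · -- the terms with `k ≥ m` of the first sum are those of the second one with `k < N - m`
    obtain ⟨r, rfl⟩ := Nat.exists_eq_add_of_le h.le
    have h1 : ∀ k ∈ Finset.range m, bOp (m - k) (cOp (k - (m + r : ℕ)) bcVacuum) = 0 :=
      fun k hk => by rw [hlow k (Finset.mem_range.1 hk), if_neg (by omega)]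
    have h2 : ∀ k ∈ Finset.range m,
        bOp (-(r + k : ℕ)) (cOp ((r + k : ℕ) - (m + r : ℕ) + m) bcVacuum) = 0 := fun k _ => by
      rw [cOp_vacuum (by omega), map_zero]
    have h3 : ∀ k ∈ Finset.range r, bOp (m - (m + k : ℕ)) (cOp ((m + k : ℕ) - (m + r : ℕ)) bcVacuum)
        = bOp (-k) (cOp (k - (m + r : ℕ) + m) bcVacuum) := fun k _ => by
      congr 2
      · push_cast; ring
      · congr 1; push_cast; ring
    rw [if_neg (by omega), zero_smul, Finset.sum_range_add, Finset.sum_eq_zero h1, zero_add,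
      Finset.sum_congr rfl h3, sub_eq_zero, add_comm m r, Finset.sum_range_add,
      add_comm r m, Finset.sum_eq_zero h2, add_zero]

/-- The Heisenberg relation between an annihilation and a creation mode. The commutator commutes with
every `b(k)` and `c(k)`, so it is a scalar, which is computed on the vacuum. -/
theorem jField_comm {m : ℕ} (hm : 0 < m) (N : ℕ) (v : BCFock) :
    jField.mode m (jField.mode (-N) v) =
      jField.mode (-N) (jField.mode m v) + (if m = N then (m : ℂ) else 0) • v := by
  rw [← sub_eq_iff_eq_add']
  refine eq_smul_of_commute_create
    (jField.mode m ∘ₗ jField.mode (-N) - jField.mode (-N) ∘ₗ jField.mode m) ?_ ?_ v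
  · rintro (i | i) v
    · have h : create (Sum.inl i) = bOp (-i) := by
        rw [bOp, if_pos (by omega)]; simp
      simp only [h, LinearMap.sub_apply, LinearMap.comp_apply, jField_bOp, map_add, map_sub]
      rw [add_right_comm (-(i : ℤ)) (-(N : ℤ)) m]
      abel
    · have h : create (Sum.inr i) = cOp (-i - 1) := by
        rw [cOp, if_pos (by omega)]; simp
      simp only [h, LinearMap.sub_apply, LinearMap.comp_apply, jField_cOp, map_sub]
      rw [add_right_comm (-(i : ℤ) - 1) (-(N : ℤ)) m]
      abel
  · rw [LinearMap.sub_apply, LinearMap.comp_apply, LinearMap.comp_apply,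
      jField_vacuum_of_nonneg (m := m) (by omega), map_zero, sub_zero, jField_jField_vacuum hm]

/-- The coefficient of the vacuum vector. -/
def vacuumCoeff : BCFock →ₗ[ℂ] ℂ := ExteriorAlgebra.algebraMapInv.toLinearMap

theorem vacuumCoeff_vacuum : vacuumCoeff bcVacuum = 1 :=
  map_one (ExteriorAlgebra.algebraMapInv (R := ℂ) (M := (ℕ ⊕ ℕ) →₀ ℂ))

theorem vacuumCoeff_create (x : ℕ ⊕ ℕ) (v : BCFock) : vacuumCoeff (create x v) = 0 := by
  simp [vacuumCoeff, create, ExteriorAlgebra.algebraMapInv]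

theorem vacuumCoeff_jField {m : ℤ} (hm : m < 0) (v : BCFock) :
    vacuumCoeff (jField.mode m v) = 0 := by
  rw [jField_apply, ← LinearMap.toAddMonoidHom_coe,
    AddMonoidHom.map_finsum _ (jField_support m v)]
  refine finsum_eq_zero_of_forall_eq_zero fun i => ?_
  rw [LinearMap.toAddMonoidHom_coe, map_sub, bOp, if_pos (by omega), cOp.eq_def (m - i - 1),
    if_pos (by omega), vacuumCoeff_create, vacuumCoeff_create, sub_zero]

/-! ### Injectivity of the boson-fermion correspondence -/

theorem indices_eq {m : ℕ →₀ ℕ} {l : List ℕ} (hl : l.Pairwise (· ≤ ·))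
    (h : Finsupp.toMultiset m = (l : Multiset ℕ)) : indices m = l := by
  refine List.Perm.eq_of_pairwise' (r := (· ≤ ·)) (Multiset.pairwise_sort _ _) hl ?_
  rw [← Multiset.coe_eq_coe, ← h]
  exact Multiset.sort_eq _ _

theorem coe_indices (m : ℕ →₀ ℕ) : (indices m : Multiset ℕ) = Finsupp.toMultiset m :=
  Multiset.sort_eq _ _

theorem indices_zero : indices 0 = [] := indices_eq List.Pairwise.nil (by simp)

theorem count_indices (m : ℕ →₀ ℕ) (i : ℕ) : (indices m).count i = m i := by
  rw [← Multiset.coe_count, coe_indices, Finsupp.count_toMultiset]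

theorem indices_sub_single (m : ℕ →₀ ℕ) (i : ℕ) :
    indices (m - Finsupp.single i 1) = (indices m).erase i := by
  refine indices_eq (List.Pairwise.erase _ (Multiset.pairwise_sort _ _)) ?_
  rw [← Multiset.coe_erase, coe_indices]
  ext a
  rw [Finsupp.count_toMultiset, Finsupp.tsub_apply]
  rcases eq_or_ne a i with rfl | h
  · simp
  · simp [Multiset.count_erase_of_ne h, Finsupp.single_eq_of_ne h]

/-- The fermionic vector `j_{-i₁-1} ⋯ j_{-i_r-1} |bc⟩`. -/
def bosonState (l : List ℕ) : BCFock :=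
  l.foldr (fun i v => jField.mode (-(i : ℤ) - 1) v) bcVacuum

theorem bosonState_cons (i : ℕ) (l : List ℕ) :
    bosonState (i :: l) = jField.mode (-(i : ℤ) - 1) (bosonState l) := rfl

theorem bosonFermion_hBasis (m : ℕ →₀ ℕ) : bosonFermion (hBasis m) = bosonState (indices m) :=
  hBasis.constr_basis ℂ _ m

/-- On monomials the annihilation mode `j_{i+1}` acts as `(i + 1) ∂/∂x_i`. The list is increasing, as
the list of indices of a monomial is; this avoids any appeal to the commutativity of the creation
modes. -/
theorem jField_bosonState (i : ℕ) (l : List ℕ) (hl : l.Pairwise (· ≤ ·)) :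
    jField.mode (i + 1) (bosonState l) =
      ((i + 1 : ℂ) * l.count i) • bosonState (l.erase i) := by
  induction l with
  | nil => simpa [bosonState] using jField_vacuum_of_nonneg (m := (i : ℤ) + 1) (by omega)
  | cons a l ih =>
    have h1 := jField_comm (m := i + 1) (Nat.succ_pos i) (a + 1) (bosonState l)
    rw [bosonState_cons, sub_eq_add_neg, ← neg_add]
    push_cast at h1
    rw [h1, ih hl.of_cons, map_smul]
    by_cases hai : a = i
    · subst hai
      simp only [if_true, List.erase_cons_head, List.count_cons_self]
      by_cases hmem : a ∈ l
      · -- in an increasing list the repeated entries are adjacent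
        obtain ⟨b, l', rfl⟩ := List.exists_cons_of_ne_nil (List.ne_nil_of_mem hmem)
        have hab : a = b := by
          rcases List.mem_cons.1 hmem with h | h
          · exact h
          · exact le_antisymm (List.rel_of_pairwise_cons hl (by simp))
              (List.rel_of_pairwise_cons hl.of_cons h)
        subst hab
        rw [List.erase_cons_head, bosonState_cons, neg_add, ← sub_eq_add_neg, ← add_smul]
        push_cast
        congr 1
        ring
      · rw [List.count_eq_zero_of_not_mem hmem]
        simp
    · rw [if_neg (by omega), List.erase_cons_tail (by simpa using hai),
        List.count_cons_of_ne hai, bosonState_cons, neg_add, ← sub_eq_add_neg]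
      simp

theorem hDeriv_hBasis (i : ℕ) (m : ℕ →₀ ℕ) :
    hDeriv i (hBasis m) = (m i : ℂ) • hBasis (m - Finsupp.single i 1) := by
  change MvPolynomial.pderiv i (MvPolynomial.basisMonomials ℕ ℂ m) =
    (m i : ℂ) • MvPolynomial.basisMonomials ℕ ℂ (m - Finsupp.single i 1)
  rw [MvPolynomial.coe_basisMonomials, MvPolynomial.pderiv_monomial, MvPolynomial.smul_monomial,
    one_mul, smul_eq_mul, mul_one]

theorem coord_hDeriv (i : ℕ) (p : HFock) (m : ℕ →₀ ℕ) :
    hBasis.coord m (hDeriv i p) = hBasis.coord (m + Finsupp.single i 1) p * (m i + 1) :=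
  MvPolynomial.coeff_pderiv (R := ℂ) p m

/-- The boson-fermion correspondence intertwines the annihilation modes of the free bosons. -/
theorem jField_bosonFermion (i : ℕ) (p : HFock) :
    jField.mode (i + 1) (bosonFermion p) = (i + 1 : ℂ) • bosonFermion (hDeriv i p) := by
  have h : jField.mode (i + 1) ∘ₗ bosonFermion = (i + 1 : ℂ) • bosonFermion ∘ₗ hDeriv i := by
    refine hBasis.ext fun m => ?_
    rw [LinearMap.comp_apply, LinearMap.smul_apply, LinearMap.comp_apply, hDeriv_hBasis, map_smul,
      bosonFermion_hBasis, bosonFermion_hBasis, indices_sub_single,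
      jField_bosonState i (indices m) (Multiset.pairwise_sort _ _), count_indices, mul_smul]
  exact LinearMap.congr_fun h p

theorem vacuumCoeff_bosonFermion (p : HFock) :
    vacuumCoeff (bosonFermion p) = hBasis.coord 0 p := by
  have h : vacuumCoeff ∘ₗ bosonFermion = hBasis.coord 0 := by
    refine hBasis.ext fun m => ?_
    rw [LinearMap.comp_apply, bosonFermion_hBasis, Module.Basis.coord_apply,
      Module.Basis.repr_self, Finsupp.single_apply]
    split_ifs with hm
    · rw [hm, indices_zero]
      exact vacuumCoeff_vacuum
    · obtain ⟨i, l, hl⟩ : ∃ i l, indices m = i :: l := by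
        refine List.exists_cons_of_ne_nil fun h => hm (Finsupp.ext fun i => ?_)
        rw [← count_indices, h, List.count_nil, Finsupp.zero_apply]
      rw [hl, bosonState_cons, vacuumCoeff_jField (by omega)]
  exact LinearMap.congr_fun h p

/-- The kernel is stable under all the derivatives `∂/∂x_i` and its elements have no constant term,
hence every coefficient of an element of the kernel vanishes. -/
theorem bosonFermion_injective : Function.Injective bosonFermion := by
  rw [← LinearMap.ker_eq_bot, LinearMap.ker_eq_bot']
  have hD : ∀ i p, bosonFermion p = 0 → bosonFermion (hDeriv i p) = 0 := fun i p hp => by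
    have h := jField_bosonFermion i p
    rw [hp, map_zero] at h
    exact (smul_eq_zero.1 h.symm).resolve_left (Nat.cast_add_one_ne_zero i)
  -- passing from `t` to `t + s` makes the claim additive in `s`, which reduces it to `s = single i n`
  have key : ∀ s t : ℕ →₀ ℕ, (∀ p, bosonFermion p = 0 → hBasis.coord t p = 0) →
      ∀ p, bosonFermion p = 0 → hBasis.coord (t + s) p = 0 := by
    intro s
    induction s using Finsupp.induction_linear with
    | zero => intro t ht; simpa using ht
    | add f g hf hg =>
      intro t ht
      rw [← add_assoc]
      exact hg _ (hf _ ht)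
    | single i n =>
      induction n with
      | zero => intro t ht; simpa using ht
      | succ n ih =>
        intro t ht p hp
        rw [Finsupp.single_add, ← add_assoc]
        have h := coord_hDeriv i p (t + Finsupp.single i n)
        rw [ih t ht _ (hD i p hp)] at h
        exact (mul_eq_zero.1 h.symm).resolve_right (Nat.cast_add_one_ne_zero _)
  intro p hp
  refine hBasis.ext_elem fun s => ?_
  rw [map_zero, Finsupp.zero_apply]
  have h0 : ∀ p, bosonFermion p = 0 → hBasis.coord 0 p = 0 := fun p hp => by
    rw [← vacuumCoeff_bosonFermion, hp, map_zero]
  simpa using key s 0 h0 p hp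

/-! ### The conformal and the weight three states -/

/-- State-field correspondence for a normally ordered product of two fields which are regular on the
vacuum. -/
theorem normalProd_vacuum (s : ℂ) (a b : FormalField BCFock)
    (ha : ∀ k : ℕ, a.mode k bcVacuum = 0) (hb : ∀ k : ℕ, b.mode k bcVacuum = 0) :
    (a.normalProd s b).mode (-1) bcVacuum = a.mode (-1) (b.mode (-1) bcVacuum) := by
  change ∑ᶠ k : ℕ, _ = _
  rw [finsum_eq_single _ 0 fun k hk => ?_]
  · have h0 := ha 0
    rw [Nat.cast_zero] at h0
    rw [Nat.cast_zero, h0]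
    simp
  · obtain ⟨k, rfl⟩ := Nat.exists_eq_succ_of_ne_zero hk
    have e : (-1 : ℤ) + (k.succ : ℕ) = k := by push_cast; ring
    rw [ha, e, hb]
    simp

/-- The vector `b(-i) c(-j) |bc⟩`. -/
def bcState (i j : ℤ) : BCFock := bOp (-i) (cOp (-j) bcVacuum)

theorem TField_vacuum : TField.mode (-1) bcVacuum = bcState 1 1 := by
  rw [TField, normalProd_vacuum]
  · simp [FormalField.deriv, bField, cField, bcState]
  · intro k
    rcases Nat.eq_zero_or_pos k with rfl | hk
    · simp [FormalField.deriv]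
    · simp [FormalField.deriv, bField, bOp_vacuum (n := k) (by omega)]
  · exact fun k => cOp_vacuum (by omega)

theorem WField_vacuum :
    WField.mode (-1) bcVacuum = bcState 2 1 - (1 / 2 : ℂ) • bcState 1 2 := by
  change (1 / 2 : ℂ) • ((bField.deriv.deriv.normalProd (-1) cField).mode (-1) bcVacuum -
    (bField.deriv.normalProd (-1) cField.deriv).mode (-1) bcVacuum) = _
  have hd : ∀ k : ℕ, bField.deriv.mode k bcVacuum = 0 := fun k => by
    rcases Nat.eq_zero_or_pos k with rfl | hk
    · simp [FormalField.deriv]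
    · simp [FormalField.deriv, bField, bOp_vacuum (n := k) (by omega)]
  have hdd : ∀ k : ℕ, bField.deriv.deriv.mode k bcVacuum = 0 := fun k => by
    rcases Nat.eq_zero_or_pos k with rfl | hk
    · simp [FormalField.deriv]
    · have h := hd (k - 1)
      rw [Nat.cast_sub hk, Nat.cast_one] at h
      rw [FormalField.deriv, LinearMap.smul_apply, h, smul_zero]
  have hc : ∀ k : ℕ, cField.mode k bcVacuum = 0 := fun k => cOp_vacuum (by omega)
  have hdc : ∀ k : ℕ, cField.deriv.mode k bcVacuum = 0 := fun k => by
    rcases Nat.eq_zero_or_pos k with rfl | hk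
    · simp [FormalField.deriv]
    · have h := hc (k - 1)
      rw [Nat.cast_sub hk, Nat.cast_one] at h
      rw [FormalField.deriv, LinearMap.smul_apply, h, smul_zero]
  rw [normalProd_vacuum _ _ _ hdd hc, normalProd_vacuum _ _ _ hd hdc, smul_sub]
  have h : (2⁻¹ : ℂ) * (-1 + -1) = -1 := by norm_num
  simp [FormalField.deriv, bField, cField, bcState, smul_smul, h]

theorem jField_bcState (n i j : ℤ) :
    jField.mode (-n) (bcState i j) =
      bOp (-i) (cOp (-j) (jField.mode (-n) bcVacuum)) + bcState (i + n) j - bcState i (j + n) := by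
  simp only [bcState, jField_bOp, jField_cOp, map_sub, neg_add]
  abel

theorem cOp_zero_bcState {i : ℤ} (hi : i ≠ 0) (j : ℤ) : cOp 0 (bcState i j) = 0 := by
  rw [bcState, cOp_bOp, if_neg (by omega), cOp_cOp, cOp_vacuum le_rfl]
  simp

/-- The state `½ (j_{-1}² + j_{-2}) |0⟩` of `H_0`. -/
def virasoroState : HFock :=
  (1 / 2 : ℂ) • (hBasis (Finsupp.single 0 2) + hBasis (Finsupp.single 1 1))

/-- The state `(⅓ j_{-1}³ + ½ j_{-1} j_{-2} + ⅙ j_{-3}) |0⟩` of `H_0`. -/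
def wState : HFock :=
  (1 / 3 : ℂ) • hBasis (Finsupp.single 0 3) +
    (1 / 2 : ℂ) • hBasis (Finsupp.single 0 1 + Finsupp.single 1 1) +
    (1 / 6 : ℂ) • hBasis (Finsupp.single 2 1)

theorem indices_single (i n : ℕ) : indices (Finsupp.single i n) = List.replicate n i :=
  indices_eq (by simp) (by
    rw [Finsupp.toMultiset_single, Multiset.nsmul_singleton, Multiset.coe_replicate])

theorem indices_zero_one : indices (Finsupp.single 0 1 + Finsupp.single 1 1) = [0, 1] :=
  indices_eq (by simp) (by simp [Finsupp.toMultiset_add, Finsupp.toMultiset_single]; rfl)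

theorem jField_vacuum_one : jField.mode (-1) bcVacuum = bcState 0 1 := by
  simpa [bcState] using jField_vacuum 1

theorem jField_vacuum_two : jField.mode (-2) bcVacuum = bcState 0 2 + bcState 1 1 := by
  simpa [bcState, Finset.sum_range_succ] using jField_vacuum 2

theorem jField_vacuum_three :
    jField.mode (-3) bcVacuum = bcState 0 3 + bcState 1 2 + bcState 2 1 := by
  simpa [bcState, Finset.sum_range_succ] using jField_vacuum 3

theorem jField_bcState_zero_left {j : ℤ} (hj : j ≠ 0) :
    jField.mode (-1) (bcState 0 j) = bcState 1 j - bcState 0 (j + 1) := by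
  rw [jField_bcState, jField_vacuum_one, bcState, neg_zero, bOp_cOp, if_neg (by omega), bOp_bOp_self]
  simp

theorem jField_bcState_one_right {i : ℤ} :
    jField.mode (-1) (bcState i 1) = bcState (i + 1) 1 - bcState i 2 := by
  rw [jField_bcState, jField_vacuum_one, bcState, neg_zero, cOp_bOp, if_neg (by omega), cOp_cOp_self]
  simp

theorem bosonFermion_virasoroState : bosonFermion virasoroState = bcState 1 1 := by
  rw [virasoroState, map_smul, map_add, bosonFermion_hBasis, bosonFermion_hBasis, indices_single,
    indices_single]
  have h1 : bosonState (List.replicate 2 0) = bcState 1 1 - bcState 0 2 := by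
    simp [bosonState, jField_vacuum_one, jField_bcState_one_right]
  have h2 : bosonState (List.replicate 1 1) = bcState 0 2 + bcState 1 1 := by
    simp [bosonState, jField_vacuum_two]
  rw [h1, h2]
  module

theorem bosonFermion_wState :
    bosonFermion wState = bcState 2 1 - (1 / 2 : ℂ) • bcState 1 2 := by
  rw [wState, map_add, map_add, map_smul, map_smul, map_smul, bosonFermion_hBasis,
    bosonFermion_hBasis, bosonFermion_hBasis, indices_single, indices_single, indices_zero_one]
  have h1 : bosonState (List.replicate 3 0) =
      bcState 2 1 - (2 : ℂ) • bcState 1 2 + bcState 0 3 := by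
    simp [bosonState, jField_vacuum_one, jField_bcState_one_right, jField_bcState_zero_left]
    module
  have h2 : bosonState [0, 1] = bcState 2 1 - bcState 0 3 := by
    simp [bosonState, jField_vacuum_two, jField_bcState_one_right, jField_bcState_zero_left]
  have h3 : bosonState (List.replicate 1 2) = bcState 0 3 + bcState 1 2 + bcState 2 1 := by
    simp [bosonState, jField_vacuum_three]
  rw [h1, h2, h3]
  module

theorem virasoroState_mem : virasoroState ∈ wAlgebra := by
  rw [wAlgebra, Submodule.mem_comap, bosonFermion_virasoroState, LinearMap.mem_ker]
  exact cOp_zero_bcState one_ne_zero 1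

theorem wState_mem : wState ∈ wAlgebra := by
  rw [wAlgebra, Submodule.mem_comap, bosonFermion_wState, LinearMap.mem_ker, map_sub, map_smul,
    cOp_zero_bcState one_ne_zero, cOp_zero_bcState two_ne_zero, smul_zero, sub_zero]

/-! ### Modes of the two states on the Heisenberg Fock spaces -/

theorem normalProd_apply {V : Type} [AddCommGroup V] [Module ℂ V] (s : ℂ) (a b : FormalField V)
    (n : ℤ) (v : V) : (a.normalProd s b).mode n v = ∑ᶠ k : ℕ,
      (a.mode (-(k : ℤ) - 1) (b.mode (n + k) v) + s • b.mode (n - k - 1) (a.mode k v)) := rfl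

theorem normalProd_one {V : Type} [AddCommGroup V] [Module ℂ V] (a : FormalField V) (n : ℤ)
    (v : V) : (a.normalProd 1 FormalField.one).mode n v = a.mode n v := by
  have hone : ∀ (m : ℤ) (w : V), (FormalField.one (V := V)).mode m w = if m = -1 then w else 0 :=
    fun m w => by
      change (if m = -1 then LinearMap.id else (0 : V →ₗ[ℂ] V)) w = _
      split_ifs <;> rfl
  rw [normalProd_apply]
  simp only [hone, one_smul]
  by_cases hn : 0 ≤ n
  · rw [finsum_eq_single _ n.toNat fun k hk => by
      rw [if_neg (by omega), if_neg (by omega), map_zero, add_zero]]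
    rw [if_neg (by omega), if_pos (by omega), map_zero, zero_add, Int.toNat_of_nonneg hn]
  · rw [finsum_eq_single _ (-n - 1).toNat fun k hk => by
      rw [if_neg (by omega), if_neg (by omega), map_zero, add_zero]]
    rw [if_pos (by omega), if_neg (by omega), add_zero]
    congr 2
    omega

theorem divDeriv_zero {V : Type} [AddCommGroup V] [Module ℂ V] (a : FormalField V) (n : ℤ)
    (v : V) : (a.divDeriv 0).mode n v = a.mode n v := by
  simp [FormalField.divDeriv, FormalField.smul]

theorem divDeriv_one {V : Type} [AddCommGroup V] [Module ℂ V] (a : FormalField V) (n : ℤ)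
    (v : V) : (a.divDeriv 1).mode n v = -(n : ℂ) • a.mode (n - 1) v := by
  simp [FormalField.divDeriv, FormalField.smul, FormalField.deriv]

theorem divDeriv_two {V : Type} [AddCommGroup V] [Module ℂ V] (a : FormalField V) (n : ℤ)
    (v : V) : (a.divDeriv 2).mode n v = ((n : ℂ) * (n - 1) / 2) • a.mode (n - 2) v := by
  simp only [FormalField.divDeriv, FormalField.smul, FormalField.deriv, Function.iterate_succ,
    Function.iterate_zero, Function.comp_apply, id_eq, LinearMap.smul_apply, smul_smul]
  rw [show n - 1 - 1 = n - 2 by ring]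
  congr 1
  push_cast [Nat.factorial]
  ring

theorem vertexMode_hBasis (α : ℂ) (n : ℤ) (m : ℕ →₀ ℕ) :
    vertexMode α n (hBasis m) = (monomialField α m).mode n :=
  hBasis.constr_basis ℂ _ m

theorem vertexMode_virasoroState (α : ℂ) (n : ℤ) (v : HFock) :
    vertexMode α n virasoroState v =
      (1 / 2 : ℂ) • ((((heisenbergField α).divDeriv 0).normalProd 1
        (((heisenbergField α).divDeriv 0).normalProd 1 FormalField.one)).mode n v +
        (((heisenbergField α).divDeriv 1).normalProd 1 FormalField.one).mode n v) := by
  rw [virasoroState, map_smul, map_add, vertexMode_hBasis, vertexMode_hBasis, monomialField,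
    monomialField, indices_single, indices_single]
  rfl

theorem vertexMode_wState (α : ℂ) (n : ℤ) (v : HFock) :
    vertexMode α n wState v =
      (1 / 3 : ℂ) • (((heisenbergField α).divDeriv 0).normalProd 1
        (((heisenbergField α).divDeriv 0).normalProd 1
          (((heisenbergField α).divDeriv 0).normalProd 1 FormalField.one))).mode n v +
      (1 / 2 : ℂ) • (((heisenbergField α).divDeriv 0).normalProd 1
        (((heisenbergField α).divDeriv 1).normalProd 1 FormalField.one)).mode n v +
      (1 / 6 : ℂ) • (((heisenbergField α).divDeriv 2).normalProd 1 FormalField.one).mode n v := by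
  rw [wState, map_add, map_add, map_smul, map_smul, map_smul, vertexMode_hBasis,
    vertexMode_hBasis, vertexMode_hBasis, monomialField, monomialField, monomialField,
    indices_single, indices_single, indices_zero_one]
  rfl

theorem heisenberg_zero (α : ℂ) (v : HFock) : heisenberg α 0 v = α • v := by
  simp [heisenberg]

theorem heisenberg_vacuum (α : ℂ) {n : ℤ} (hn : 0 < n) : heisenberg α n hVacuum = 0 := by
  rw [heisenberg, if_neg (by omega), if_neg (by omega), LinearMap.smul_apply]
  have h : hDeriv (n - 1).toNat hVacuum = 0 := MvPolynomial.pderiv_one (R := ℂ)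
  rw [h, smul_zero]

/-- `|α⟩` is annihilated by the modes `f₍ₙ₎`, `n > d`, and is an eigenvector of `f₍d₎` with
eigenvalue `c`. -/
def VacuumWeight (f : FormalField HFock) (d : ℤ) (c : ℂ) : Prop :=
  (∀ n, d < n → f.mode n hVacuum = 0) ∧ f.mode d hVacuum = c • hVacuum

/-- On the vacuum vector only the zero mode of the free boson contributes to the non-negative modes
of `:j(z) f(z):`. -/
theorem VacuumWeight.normalProd {α c : ℂ} {d : ℤ} {f : FormalField HFock}
    (hf : VacuumWeight f d c) :
    VacuumWeight (((heisenbergField α).divDeriv 0).normalProd 1 f) (d + 1) (α * c) := by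
  have key : ∀ n, d < n → (((heisenbergField α).divDeriv 0).normalProd 1 f).mode n hVacuum =
      α • f.mode (n - 1) hVacuum := by
    intro n hn
    simp only [normalProd_apply, divDeriv_zero, one_smul]
    change ∑ᶠ k : ℕ, (heisenberg α _ _ + f.mode _ (heisenberg α k hVacuum)) = _
    rw [finsum_eq_single _ 0 fun k hk => by
      rw [hf.1 _ (by omega), heisenberg_vacuum α (by omega), map_zero, map_zero, add_zero]]
    rw [hf.1 _ (by omega), map_zero, zero_add, Nat.cast_zero, heisenberg_zero, map_smul, sub_zero]
  refine ⟨fun n hn => ?_, ?_⟩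
  · rw [key n (by omega), hf.1 _ (by omega), smul_zero]
  · rw [key _ (by omega), add_sub_cancel_right, hf.2, smul_smul]

theorem vacuumWeight_divDeriv_zero (α : ℂ) :
    VacuumWeight (((heisenbergField α).divDeriv 0).normalProd 1 FormalField.one) 0 α := by
  refine ⟨fun n hn => ?_, ?_⟩
  · rw [normalProd_one, divDeriv_zero]
    exact heisenberg_vacuum α hn
  · rw [normalProd_one, divDeriv_zero]
    exact heisenberg_zero α _

theorem vacuumWeight_divDeriv_one (α : ℂ) :
    VacuumWeight (((heisenbergField α).divDeriv 1).normalProd 1 FormalField.one) 1 (-α) := by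
  refine ⟨fun n hn => ?_, ?_⟩
  · rw [normalProd_one, divDeriv_one]
    exact (congrArg _ (heisenberg_vacuum α (by omega))).trans (smul_zero _)
  · rw [normalProd_one, divDeriv_one]
    exact (congrArg _ (heisenberg_zero α _)).trans (by simp)

theorem vacuumWeight_divDeriv_two (α : ℂ) :
    VacuumWeight (((heisenbergField α).divDeriv 2).normalProd 1 FormalField.one) 2 α := by
  refine ⟨fun n hn => ?_, ?_⟩
  · rw [normalProd_one, divDeriv_two]
    exact (congrArg _ (heisenberg_vacuum α (by omega))).trans (smul_zero _)
  · rw [normalProd_one, divDeriv_two]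
    refine (congrArg _ (heisenberg_zero α _)).trans ?_
    rw [smul_smul]
    congr 1
    push_cast
    ring

theorem virasoroState_vacuum_of_pos (α : ℂ) {n : ℤ} (hn : 1 < n) :
    vertexMode α n virasoroState hVacuum = 0 := by
  rw [vertexMode_virasoroState, (vacuumWeight_divDeriv_zero α).normalProd.1 n (by omega),
    (vacuumWeight_divDeriv_one α).1 n hn, add_zero, smul_zero]

theorem wState_vacuum_of_pos (α : ℂ) {n : ℤ} (hn : 2 < n) :
    vertexMode α n wState hVacuum = 0 := by
  rw [vertexMode_wState, (vacuumWeight_divDeriv_zero α).normalProd.normalProd.1 n (by omega),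
    (vacuumWeight_divDeriv_one α).normalProd.1 n (by omega), (vacuumWeight_divDeriv_two α).1 n hn]
  simp

theorem wState_vacuum (α : ℂ) :
    vertexMode α 2 wState hVacuum = (1 / 6 * α * (α - 1) * (2 * α - 1)) • hVacuum := by
  have h1 := (vacuumWeight_divDeriv_zero α).normalProd (α := α) |>.normalProd (α := α) |>.2
  have h2 := (vacuumWeight_divDeriv_one α).normalProd (α := α) |>.2
  rw [vertexMode_wState, (vacuumWeight_divDeriv_two α).2]
  norm_num at h1 h2
  rw [h1, h2]
  module

/-! ### The grading by `L_0` -/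

/-- The conformal degree `∑ (i + 1) sᵢ` of the monomial `∏ xᵢ^{sᵢ}`, the variable `x_i` standing
for `j_{-i-1}`. -/
def degree (s : ℕ →₀ ℕ) : ℕ := s.sum fun i c => (i + 1) * c

theorem degree_eq_zero {s : ℕ →₀ ℕ} : degree s = 0 ↔ s = 0 := by
  simp [degree, Finsupp.sum, Finset.sum_eq_zero_iff, Finsupp.ext_iff]

theorem heisenberg_heisenberg_hBasis (α : ℂ) (k : ℕ) (s : ℕ →₀ ℕ) :
    heisenberg α (-(k : ℤ) - 1) (heisenberg α (k + 1) (hBasis s)) =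
      (((k + 1) * s k : ℕ) : ℂ) • hBasis s := by
  have h : hX k * hDeriv k (hBasis s) = s k • hBasis s :=
    MvPolynomial.X_mul_pderiv_monomial (R := ℂ)
  rw [heisenberg, heisenberg, if_pos (by omega), if_neg (by omega), if_neg (by omega),
    LinearMap.smul_apply, map_smul, LinearMap.mulLeft_apply,
    show (-(-(k : ℤ) - 1) - 1).toNat = k by omega, show ((k : ℤ) + 1 - 1).toNat = k by omega, h,
    ← Nat.cast_smul_eq_nsmul ℂ, smul_smul]
  push_cast
  rfl

theorem vertexMode_virasoroState_hBasis (α : ℂ) (s : ℕ →₀ ℕ) :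
    vertexMode α 1 virasoroState (hBasis s) =
      (1 / 2 * α * (α - 1) + degree s) • hBasis s := by
  have hterm : ∀ k : ℕ, heisenberg α (-(k : ℤ) - 1) (heisenberg α (1 + k) (hBasis s)) =
      (((k + 1) * s k : ℕ) : ℂ) • hBasis s := fun k => by
    rw [add_comm (1 : ℤ), heisenberg_heisenberg_hBasis]
  obtain ⟨B, hB⟩ := s.support.bddAbove
  have hs : ∀ k, B < k → s k = 0 := fun k hk => by
    by_contra h
    exact absurd (hB (Finset.mem_coe.2 (Finsupp.mem_support_iff.2 h))) (by omega)
  have hdeg : ∑ k ∈ Finset.range (B + 1), ((((k + 1) * s k : ℕ) : ℂ) • hBasis s) =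
      (degree s : ℂ) • hBasis s := by
    rw [← Finset.sum_smul, ← Nat.cast_sum, degree, Finsupp.sum_of_support_subset]
    · exact fun k hk => Finset.mem_range.2 (Nat.lt_succ_of_le (hB hk))
    · simp
  have hjj : (((heisenbergField α).divDeriv 0).normalProd 1
      (((heisenbergField α).divDeriv 0).normalProd 1 FormalField.one)).mode 1 (hBasis s) =
      (α ^ 2 + 2 * degree s) • hBasis s := by
    simp only [normalProd_apply _ _ (FormalField.normalProd _ _ _), normalProd_one, divDeriv_zero,
      one_smul]
    change ∑ᶠ k : ℕ, (heisenberg α _ (heisenberg α _ _) + heisenberg α _ (heisenberg α _ _)) = _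
    rw [finsum_eq_sum_of_support_subset (s := Finset.range (B + 2))]
    · rw [Finset.sum_add_distrib, Finset.sum_range_succ, Finset.sum_range_succ' _ (B + 1),
        Finset.sum_congr rfl fun k _ => hterm k, hdeg, hterm, hs _ (Nat.lt_succ_self B)]
      have h2 : ∀ k ∈ Finset.range (B + 1), heisenberg α (1 - ((k + 1 : ℕ) : ℤ) - 1)
          (heisenberg α ((k + 1 : ℕ) : ℤ) (hBasis s)) = (((k + 1) * s k : ℕ) : ℂ) • hBasis s :=
        fun k _ => by
          rw [← heisenberg_heisenberg_hBasis α k s]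
          push_cast
          congr 2
          ring
      rw [Finset.sum_congr rfl h2, hdeg]
      simp only [Nat.cast_zero, sub_zero, sub_self, heisenberg_zero, smul_smul, mul_zero, zero_smul]
      module
    · intro k hk
      rw [Finset.coe_range, Set.mem_Iio]
      by_contra h
      refine hk ?_
      obtain ⟨k, rfl⟩ := Nat.exists_eq_add_of_lt (show 0 < k by omega)
      change heisenberg α _ (heisenberg α _ _) + heisenberg α _ (heisenberg α _ _) = 0
      have e := heisenberg_heisenberg_hBasis α k s
      rw [hterm, hs _ (by omega), zero_add, show (1 : ℤ) - (k + 1 : ℕ) - 1 = -k - 1 by omega,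
        show ((k + 1 : ℕ) : ℤ) = k + 1 by omega, e, hs _ (by omega)]
      simp
  rw [vertexMode_virasoroState, hjj, normalProd_one, divDeriv_one]
  change (1 / 2 : ℂ) • (_ + _ • heisenberg α (1 - 1) _) = _
  rw [sub_self, heisenberg_zero]
  push_cast
  module

theorem hBasis_zero : hBasis 0 = hVacuum := rfl

theorem virasoroState_vacuum (α : ℂ) :
    vertexMode α 1 virasoroState hVacuum = (1 / 2 * α * (α - 1)) • hVacuum := by
  have h := vertexMode_virasoroState_hBasis α 0
  rwa [degree_eq_zero.2 rfl, Nat.cast_zero, add_zero, hBasis_zero] at h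

/-! ### Irreducibility -/

/-- The polynomial `∏_{d ∈ S} (1 - (L_0 - h) / d)` in `L_0` acts on monomials by scalars, fixes the
vacuum vector and annihilates all monomials of degree in `S`. -/
theorem exists_projector (α : ℂ) (S : Finset ℕ) (hS : 0 ∉ S) :
    ∃ r : ModeAlgebra α, r • hVacuum = hVacuum ∧
      ∀ s, degree s ∈ S → r • hBasis s = 0 := by
  suffices h : ∃ r : ModeAlgebra α, (∀ s, r • hBasis s =
      (∏ d ∈ S, (1 - (degree s : ℂ) / d)) • hBasis s) by
    obtain ⟨r, hr⟩ := h
    refine ⟨r, ?_, fun s hs => ?_⟩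
    · rw [← hBasis_zero, hr, degree_eq_zero.2 rfl]
      simp
    · rw [hr, Finset.prod_eq_zero hs, zero_smul]
      rw [div_self (Nat.cast_ne_zero.2 fun h => hS (h ▸ hs)), sub_self]
  let L : ModeAlgebra α := stateMode α ⟨virasoroState, virasoroState_mem⟩ 1
  have hL : ∀ s, L • hBasis s = (1 / 2 * α * (α - 1) + degree s) • hBasis s :=
    vertexMode_virasoroState_hBasis α
  clear hS
  induction S using Finset.induction_on with
  | empty => exact ⟨1, fun s => by simp⟩
  | insert d S hd ih =>
    obtain ⟨r, hr⟩ := ih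
    refine ⟨(algebraMap ℂ _ (1 + 1 / 2 * α * (α - 1) / d) - algebraMap ℂ _ (1 / d) * L) * r,
      fun s => ?_⟩
    rw [mul_smul, hr, smul_algebra_smul_comm, sub_smul, mul_smul, hL, algebraMap_smul, algebraMap_smul,
      Finset.prod_insert hd]
    module

/-- A submodule of the module generated by `|α⟩` which has an element with non-zero constant term is
everything, because it contains `|α⟩`. -/
theorem coord_zero_of_mem {α : ℂ} {U : Submodule (ModeAlgebra α) (Generated α)} (hU : U ≠ ⊤)
    {v : Generated α} (hv : v ∈ U) : hBasis.coord 0 (v : HFock) = 0 := by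
  by_contra hne
  refine hU ?_
  obtain ⟨r, hr1, hr⟩ := exists_projector α
    (((hBasis.repr (v : HFock)).support.image degree).erase 0) (Finset.notMem_erase _ _)
  have hrv : r • (v : HFock) = hBasis.coord 0 (v : HFock) • hVacuum := by
    conv_lhs => rw [← hBasis.linearCombination_repr (v : HFock), Finsupp.linearCombination_apply,
      Finsupp.sum, Finset.smul_sum]
    rw [Finset.sum_eq_single 0]
    · exact (smul_algebra_smul_comm _ r _).trans
        (congrArg (hBasis.coord 0 (v : HFock) • ·) hr1)
    · intro s hs hs0
      refine (smul_algebra_smul_comm _ r _).trans ?_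
      refine (congrArg _ (hr s (Finset.mem_erase.2 ⟨?_, Finset.mem_image_of_mem _ hs⟩))).trans
        (smul_zero _)
      exact fun h => hs0 (degree_eq_zero.1 h)
    · intro h
      exact absurd (Finsupp.notMem_support_iff.1 h) hne
  have hvac : (⟨hVacuum, Submodule.mem_span_singleton_self _⟩ : Generated α) ∈ U := by
    have h : (⟨hVacuum, Submodule.mem_span_singleton_self _⟩ : Generated α) =
        (algebraMap ℂ (ModeAlgebra α) (hBasis.coord 0 (v : HFock))⁻¹ * r) • v := by
      refine Subtype.ext ?_
      rw [Submodule.coe_smul, mul_smul, hrv, algebraMap_smul, inv_smul_smul₀ hne]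
    rw [h]
    exact U.smul_mem _ hv
  rw [eq_top_iff]
  rintro ⟨x, hx⟩ -
  obtain ⟨a, rfl⟩ := Submodule.mem_span_singleton.1 hx
  exact U.smul_mem a hvac

theorem coord_zero_of_mem_maxProper {α : ℂ} {v : Generated α} (hv : v ∈ maxProper α) :
    hBasis.coord 0 (v : HFock) = 0 := by
  rw [maxProper, sSup_eq_iSup'] at hv
  refine Submodule.iSup_induction _ (motive := fun x : Generated α => hBasis.coord 0 (x : HFock) = 0)
    hv (fun U x hx => coord_zero_of_mem U.2 hx) ?_ fun x y hx hy => ?_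
  · exact map_zero _
  · exact (map_add _ _ _).trans (by rw [hx, hy, add_zero])

theorem highestVector_ne_zero (α : ℂ) : highestVector α ≠ 0 := by
  intro h
  have h1 := coord_zero_of_mem_maxProper ((Submodule.Quotient.mk_eq_zero _).1 h)
  change hBasis.coord 0 hVacuum = 0 at h1
  rw [← hBasis_zero, Module.Basis.coord_apply, Module.Basis.repr_self,
    Finsupp.single_eq_same] at h1
  exact one_ne_zero h1

theorem span_highestVector (α : ℂ) : Submodule.span (ModeAlgebra α) {highestVector α} = ⊤ := by
  rw [eq_top_iff]
  rintro x -
  obtain ⟨⟨x, hx⟩, rfl⟩ := Submodule.mkQ_surjective _ x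
  obtain ⟨a, rfl⟩ := Submodule.mem_span_singleton.1 hx
  exact Submodule.mem_span_singleton.2 ⟨a, rfl⟩

/-- The sum `maxProper α` of the proper submodules does not contain `|α⟩`, so it is the largest proper
submodule. -/
theorem isSimpleModule_V (α : ℂ) : IsSimpleModule (ModeAlgebra α) (V α) := by
  rw [isSimpleModule_iff_isCoatom]
  refine ⟨fun h => highestVector_ne_zero α ?_, fun U hU => ?_⟩
  · exact (Submodule.Quotient.mk_eq_zero _).2 (h ▸ Submodule.mem_top)
  · by_contra hne
    exact absurd (le_sSup (show U ∈ {U | U ≠ ⊤} from hne)) (not_le_of_gt hU)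

theorem smul_highestVector {α : ℂ} {a : ModeAlgebra α} {c : ℂ}
    (h : a • hVacuum = c • hVacuum) : a • highestVector α = c • highestVector α :=
  congrArg (maxProper α).mkQ
    (Subtype.ext h : a • (⟨hVacuum, Submodule.mem_span_singleton_self _⟩ : Generated α) = c • _)

/-! ### Uniqueness of the two states -/

theorem isVirasoroState_iff {ω : wAlgebra} : IsVirasoroState ω ↔ (ω : HFock) = virasoroState := by
  rw [IsVirasoroState, TField_vacuum, ← bosonFermion_virasoroState, bosonFermion_injective.eq_iff]

theorem isWState_iff {w : wAlgebra} : IsWState w ↔ (w : HFock) = wState := by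
  rw [IsWState, WField_vacuum, ← bosonFermion_wState, bosonFermion_injective.eq_iff]

end WThree

end

theorem mainTheorem5 :
    (∃! ω : WThree.wAlgebra, WThree.IsVirasoroState ω) ∧
    (∃! w : WThree.wAlgebra, WThree.IsWState w) ∧
    ∀ (ω w : WThree.wAlgebra), WThree.IsVirasoroState ω → WThree.IsWState w → ∀ α : ℂ,
      IsSimpleModule (WThree.ModeAlgebra α) (WThree.V α) ∧
      WThree.IsHighestWeightVector α ω w (WThree.highestVector α)
        (1 / 2 * α * (α - 1)) (1 / 6 * α * (α - 1) * (2 * α - 1)) := by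
  refine ⟨⟨⟨WThree.virasoroState, WThree.virasoroState_mem⟩, WThree.isVirasoroState_iff.2 rfl,
    fun ω hω => Subtype.ext (WThree.isVirasoroState_iff.1 hω)⟩,
    ⟨⟨WThree.wState, WThree.wState_mem⟩, WThree.isWState_iff.2 rfl,
    fun w hw => Subtype.ext (WThree.isWState_iff.1 hw)⟩, ?_⟩
  rintro ⟨ω, hω⟩ ⟨w, hw⟩ h1 h2 α
  obtain rfl : ω = WThree.virasoroState := WThree.isVirasoroState_iff.1 h1
  obtain rfl : w = WThree.wState := WThree.isWState_iff.1 h2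
  refine ⟨WThree.isSimpleModule_V α, WThree.highestVector_ne_zero α, WThree.span_highestVector α,
    fun n hn => ⟨?_, ?_⟩, WThree.smul_highestVector (WThree.virasoroState_vacuum α),
    WThree.smul_highestVector (WThree.wState_vacuum α)⟩
  · refine (WThree.smul_highestVector (c := 0) ?_).trans (zero_smul _ _)
    exact (WThree.virasoroState_vacuum_of_pos α (by omega)).trans (zero_smul _ _).symm
  · refine (WThree.smul_highestVector (c := 0) ?_).trans (zero_smul _ _)
    exact (WThree.wState_vacuum_of_pos α (by omega)).trans (zero_smul _ _).symm
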